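/- **Theorem.** Let $(X_i,Y_i)_{i\ge 1}$ be i.i.d. random vectors with values in $\mathbb{R}^p\times\mathbb{R}$ and let $x\in\mathbb{R}^p$ satisfy $p_0=P(X_1\le x)>0$ (componentwise inequality). Write $F(y/x)=P(Y_1\le y\mid X_1\le x)$ and $\phi(x)=\sup\{y: F(y/x)<1\}$. Assume the following. 1. $F(\cdot/x)$ belongs to the domain of attraction of the type III generalized extreme value distributions with extreme value index $\xi_0<0$: $\phi(x)<\infty$ and, for every $v>0$, $$\lim_{z\downarrow 0}\frac{1-F(\phi(x)-vz\,/\,x)}{1-F(\phi(x)-z\,/\,x)}= v^{-1/\xi_0}.$$ 2. The conditional law of $Y_1$ given $X_1\le x$ has a Lebesgue density $f_x$, and there is $y_0<\phi(x)$ such that $f_x$ is monotone (increasing or decreasing) on $[y_0,\phi(x))$. 3. $\tau_n\to 1$, and $n(1-\tau_n)\to\infty$ at least polynomially: there are $C,\delta>0$ with $n(1-\tau_n)\ge C n^{\delta}$ for all large $n$. For $\tau\in(0,1)$ let $\hat q_n(\tau)$ be any minimizer over $q\in\mathbb{R}$ of $$\sum_{i=1}^n \rho_\tau(Y_i-q)\,\mathbf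 1\{X_i\le x\},\qquad \rho_\tau(u)=(\tau-\mathbf 1\{u\le 0\})\,u .$$ Let $R\ge 1$ be an integer, let $w_1,\dots,w_R$ be real weights with $\sum_{r=1}^R w_r=1$, and let $l,m$ be positive constants with $l\ne 1$ and $m\neq 1$. Put $t_n=1-\tau_n$ and define $$\hat\xi_n=\sum_{r=1}^R\frac{-w_r}{\log l}\,\log\!\left(\frac{\hat q_n(1-m l^{r}t_n)-\hat q_n(1-l^{r}t_n)}{\hat q_n(1-m l^{r-1}t_n)-\hat q_n(1-l^{r-1}t_n)}\right),$$ where the $\hat q_n$ at indices outside $(0,1)$ (which occur for finitely many $n$ only) are arbitrary, and $\hat\xi_n$ is given some conventional value when one of the ratios is undefined or not positive. Then, as $n\to\infty$, the probability that all $R$ ratios are well defined and positive tends to $1$, and $\hat\xi_n\to\xi_0$ in probability. -/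

import Mathlib

open Filter Topology MeasureTheory ProbabilityTheory

noncomputable section

/-- The check function `ρ_τ(u) = (τ - 1{u ≤ 0}) u`. -/
def checkFun (τ u : ℝ) : ℝ := (τ - if u ≤ 0 then 1 else 0) * u

/-- The sample objective `q ↦ ∑_{i < n} ρ_τ(Y_i - q) 1{X_i ≤ x}`; the order on `Fin p → ℝ`
is componentwise. -/
def quantileObjective {Ω : Type*} {p : ℕ} (X : ℕ → Ω → Fin p → ℝ) (Y : ℕ → Ω → ℝ)
    (x : Fin p → ℝ) (n : ℕ) (τ : ℝ) (ω : Ω) (q : ℝ) : ℝ :=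
  open Classical in
  ∑ i ∈ Finset.range n, checkFun τ (Y i ω - q) * (if X i ω ≤ x then 1 else 0)

/-- `qhat n τ ω` is a minimizer of the sample objective, for every sample size and every
quantile index in `(0, 1)`. Any choice among several minimizers is allowed, and nothing is
required for indices outside `(0, 1)`. -/
def IsQuantileEstimator {Ω : Type*} {p : ℕ} (X : ℕ → Ω → Fin p → ℝ) (Y : ℕ → Ω → ℝ)
    (x : Fin p → ℝ) (qhat : ℕ → ℝ → Ω → ℝ) : Prop :=
  ∀ n : ℕ, ∀ τ ∈ Set.Ioo (0 : ℝ) 1, ∀ ω : Ω,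
    IsMinOn (quantileObjective X Y x n τ ω) Set.univ (qhat n τ ω)

/-- The conditional law of `Y` given the event `X ≤ x`. -/
def condLaw {Ω : Type*} [MeasurableSpace Ω] (P : Measure Ω) {p : ℕ}
    (X : Ω → Fin p → ℝ) (Y : Ω → ℝ) (x : Fin p → ℝ) : Measure ℝ :=
  (ProbabilityTheory.cond P {ω | X ω ≤ x}).map Y

/-- The distribution function `F(y/x) = P(Y ≤ y | X ≤ x)`. -/
def condDF {Ω : Type*} [MeasurableSpace Ω] (P : Measure Ω) {p : ℕ}
    (X : Ω → Fin p → ℝ) (Y : Ω → ℝ) (x : Fin p → ℝ) (y : ℝ) : ℝ :=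
  (condLaw P X Y x).real (Set.Iic y)

/-- The right endpoint `sup {z | F z < 1}` of a distribution function. -/
def rightEndpoint (F : ℝ → ℝ) : ℝ := sSup {z | F z < 1}

/-- `F` has a finite right endpoint and belongs to the domain of attraction of the type III
generalized extreme value distributions with index `ξ < 0`. -/
def InTypeThreeDomain (F : ℝ → ℝ) (ξ : ℝ) : Prop :=
  ξ < 0 ∧ BddAbove {z | F z < 1} ∧
    ∀ v : ℝ, 0 < v →
      Tendsto (fun z : ℝ => (1 - F (rightEndpoint F - v * z)) / (1 - F (rightEndpoint F - z)))
        (𝓝[>] 0) (𝓝 (v ^ (-1 / ξ)))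

/-- `ν` has a Lebesgue density that is monotone (increasing or decreasing) on `[y₀, e)` for some
`y₀ < e`. -/
def HasTailMonotoneDensity (ν : Measure ℝ) (e : ℝ) : Prop :=
  ∃ f : ℝ → ℝ, Measurable f ∧ (∀ y, 0 ≤ f y) ∧
    ν = (volume : Measure ℝ).withDensity (fun y => ENNReal.ofReal (f y)) ∧
    ∃ y₀ < e, MonotoneOn f (Set.Ico y₀ e) ∨ AntitoneOn f (Set.Ico y₀ e)

/-- `τ_n → 1`, and `n (1 - τ_n)` tends to infinity at least at a polynomial rate. -/
def IsIntermediate (τ : ℕ → ℝ) : Prop :=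
  Tendsto τ atTop (𝓝 1) ∧
    ∃ C > (0 : ℝ), ∃ δ > (0 : ℝ), ∀ᶠ n : ℕ in atTop, C * (n : ℝ) ^ δ ≤ (n : ℝ) * (1 - τ n)

/-- The spacing of the estimated quantiles at the upper-tail probabilities `m s` and `s`, that is
at the quantile indices `1 - m s` and `1 - s`. -/
def tailSpacing {Ω : Type*} (qhat : ℕ → ℝ → Ω → ℝ) (m s : ℝ) (n : ℕ) (ω : Ω) : ℝ :=
  qhat n (1 - m * s) ω - qhat n (1 - s) ω

/-- All the spacing ratios are positive, so that their logarithms are genuine; in particular no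
denominator vanishes. -/
def PickandsDefined {Ω : Type*} (qhat : ℕ → ℝ → Ω → ℝ) (τ : ℕ → ℝ) (R : ℕ)
    (l m : ℝ) (n : ℕ) (ω : Ω) : Prop :=
  ∀ r ∈ Finset.Icc 1 R, 0 < tailSpacing qhat m (l ^ r * (1 - τ n)) n ω /
    tailSpacing qhat m (l ^ (r - 1) * (1 - τ n)) n ω

/-- The weighted Pickands-type estimator of the extreme value index. -/
def pickandsEstimator {Ω : Type*} (qhat : ℕ → ℝ → Ω → ℝ) (τ : ℕ → ℝ) (R : ℕ) (w : ℕ → ℝ)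
    (l m : ℝ) (n : ℕ) (ω : Ω) : ℝ :=
  ∑ r ∈ Finset.Icc 1 R, -w r / Real.log l *
    Real.log (tailSpacing qhat m (l ^ r * (1 - τ n)) n ω /
      tailSpacing qhat m (l ^ (r - 1) * (1 - τ n)) n ω)

end

/-!
Write `e` for the right endpoint of `F(· / x)` and `G z = 1 - F(e - z / x)`, a function that varies
regularly at `0+` with index `α = -1 / ξ₀ > 0`. Choose `z n` with `G (z n) = t n`, where
`t n = 1 - τ n`; then `G (v * z n) / t n → v ^ α` for every `v > 0`.

The core is the consistency of intermediate quantiles on the scale `z n`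
(`tendsto_endpoint_sub_quantile_div`): for every `c > 0`,
`(e - qhat n (1 - c * t n)) / z n → c ^ (1 / α)` in probability. A minimizer `q` of the weighted
check objective at index `1 - s` satisfies `#{Y > q} ≤ s N ≤ #{Y ≥ q}`, where only observations with
`X ≤ x` are counted and `N` is their number. Comparing `q` with `e - v * z n` therefore compares the
number of observations beyond that threshold, about `n p₀ v ^ α t n` by Chebyshev's inequality and
`n t n → ∞` (`tendsto_count_div`), with `c t n N`, about `n p₀ c t n`.

Consequently the spacing at `c * t n`, divided by `z n`, tends to
`c ^ (1 / α) * (1 - m ^ (1 / α))`, which is nonzero as `m ≠ 1`. Each of the ratios then tends to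
`l ^ (1 / α) = l ^ (-ξ₀) > 0`, whose logarithm is `-ξ₀ * log l`, and the weights sum to one. A
first-order expansion of the quantiles suffices because, for a negative index, the leading terms do
not cancel in the spacings. The density enters by making `F(· / x)` continuous.

Convergence in probability to a constant is expressed as convergence along a filter on `ℕ × Ω`
(`probFilter`), so that continuous functions, quotients and finite sums pass to the limit without
any measurability of the estimators.
-/

/-! ### Convergence in probability along a filter -/

/-- The filter on `ℕ × Ω` of the sequences of events whose probability tends to one. Convergence of
`f` along it to a constant is convergence in probability of `fun n ω => f (n, ω)`. The complements
are measured by the outer measure, so nothing has to be measurable. -/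
def probFilter {Ω : Type*} [MeasurableSpace Ω] (P : Measure Ω) : Filter (ℕ × Ω) where
  sets := {S | Tendsto (fun n => P {ω | (n, ω) ∉ S}) atTop (𝓝 0)}
  univ_sets := by simp
  sets_of_superset {S T} hS hST :=
    tendsto_of_tendsto_of_tendsto_of_le_of_le tendsto_const_nhds hS (fun _ => zero_le)
      (fun _ => measure_mono fun _ h h' => h (hST h'))
  inter_sets {S T} hS hT := by
    have h := Tendsto.add hS hT
    rw [add_zero] at h
    refine tendsto_of_tendsto_of_tendsto_of_le_of_le tendsto_const_nhds h (fun _ => zero_le)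
      (fun n => (measure_mono ?_).trans (measure_union_le _ _))
    intro ω hω
    simp only [Set.mem_ofPred_eq, Set.mem_inter_iff, not_and_or] at hω
    exact hω

section ProbFilter

variable {Ω : Type*} [MeasurableSpace Ω] {P : Measure Ω}

lemma eventually_probFilter_iff {Q : ℕ × Ω → Prop} :
    (∀ᶠ k in probFilter P, Q k) ↔ Tendsto (fun n => P {ω | ¬ Q (n, ω)}) atTop (𝓝 0) :=
  Iff.rfl

lemma tendsto_fst_probFilter : Tendsto Prod.fst (probFilter P) atTop := by
  intro S hS
  refine tendsto_const_nhds.congr' ?_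
  filter_upwards [hS] with n hn
  simp [hn]

lemma tendstoInMeasure_of_tendsto_probFilter {f : ℕ → Ω → ℝ} {a : ℝ}
    (h : Tendsto (fun k : ℕ × Ω => f k.1 k.2) (probFilter P) (𝓝 a)) :
    TendstoInMeasure P f atTop (fun _ => a) := by
  rw [tendstoInMeasure_iff_dist]
  intro ε hε
  simpa using eventually_probFilter_iff.1 ((Metric.tendsto_nhds.1 h) ε hε)

end ProbFilter

/-! ### A law of large numbers for rare events -/

section Count

variable {Ω E : Type*} [MeasurableSpace Ω] [MeasurableSpace E] {P : Measure Ω}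
  [IsProbabilityMeasure P]

/-- Chebyshev's inequality for the number of visits to a set by an i.i.d. sample; the variance of
the count is at most its mean. -/
lemma measure_count_deviation_le {Z : ℕ → Ω → E} (hZ : ∀ i, Measurable (Z i))
    (hind : iIndepFun Z P) (hid : ∀ i, IdentDistrib (Z i) (Z 0) P P) {A : Set E}
    (hA : MeasurableSet A) (n : ℕ) {c : ℝ} (hc : 0 < c) :
    P {ω | c ≤ |∑ i ∈ Finset.range n, A.indicator (fun _ => (1 : ℝ)) (Z i ω)
      - n * P.real (Z 0 ⁻¹' A)|} ≤ ENNReal.ofReal (n * P.real (Z 0 ⁻¹' A) / c ^ 2) := by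
  set g : E → ℝ := A.indicator (fun _ => (1 : ℝ)) with hg
  have hgm : Measurable g := measurable_const.indicator hA
  have hg2 : ∀ z, g z ^ 2 = g z := fun z => by
    by_cases hz : z ∈ A <;> simp [hg, hz]
  have hmem : ∀ i, MemLp (g ∘ Z i) 2 P := fun i =>
    MemLp.of_bound (hgm.comp (hZ i)).aestronglyMeasurable 1 (ae_of_all _ fun ω => by
      by_cases hz : Z i ω ∈ A <;> simp [hg, hz])
  have hmean : ∀ i, ∫ ω, (g ∘ Z i) ω ∂P = P.real (Z 0 ⁻¹' A) := fun i => by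
    have h1 : ∫ ω, (g ∘ Z i) ω ∂P = ∫ ω, (g ∘ Z 0) ω ∂P := ((hid i).comp hgm).integral_eq
    rw [h1]
    have h2 : (g ∘ Z 0) = (Z 0 ⁻¹' A).indicator 1 := by
      ext ω; by_cases hz : Z 0 ω ∈ A <;> simp [hg, hz]
    rw [h2, integral_indicator_one (hZ 0 hA)]
  have hvar : Var[∑ i ∈ Finset.range n, g ∘ Z i; P] ≤ n * P.real (Z 0 ⁻¹' A) := by
    rw [IndepFun.variance_sum (fun i _ => hmem i)
      (fun i _ j _ hij => (hind.indepFun hij).comp hgm hgm)]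
    calc ∑ i ∈ Finset.range n, Var[g ∘ Z i; P]
        ≤ ∑ i ∈ Finset.range n, P.real (Z 0 ⁻¹' A) := by
          refine Finset.sum_le_sum fun i _ => ?_
          refine (variance_le_expectation_sq (hgm.comp (hZ i)).aestronglyMeasurable).trans ?_
          rw [← hmean i]
          exact le_of_eq (integral_congr_ae (ae_of_all _ fun ω => by simp [hg2]))
      _ = n * P.real (Z 0 ⁻¹' A) := by simp
  have hE : ∫ ω, (∑ i ∈ Finset.range n, g ∘ Z i) ω ∂P = n * P.real (Z 0 ⁻¹' A) := by
    simp only [Finset.sum_apply]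
    rw [integral_finsetSum _ (fun i _ => (hmem i).integrable one_le_two)]
    simp only [hmean, Finset.sum_const, Finset.card_range, nsmul_eq_mul]
  have h := meas_ge_le_variance_div_sq (memLp_finsetSum' (Finset.range n) fun i _ => hmem i) hc
  rw [hE] at h
  simp only [Finset.sum_apply, Function.comp_apply] at h
  exact h.trans (ENNReal.ofReal_le_ofReal (by gcongr))

/-- If `A n` has probability about `L * s n` with `n * s n → ∞`, then the number of visits to `A n`
among the first `n` observations is about `L * (n * s n)` in probability. -/
lemma tendsto_count_div {Z : ℕ → Ω → E} (hZ : ∀ i, Measurable (Z i))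
    (hind : iIndepFun Z P) (hid : ∀ i, IdentDistrib (Z i) (Z 0) P P) {A : ℕ → Set E}
    (hA : ∀ n, MeasurableSet (A n)) {s : ℕ → ℝ}
    (hs : Tendsto (fun n : ℕ => n * s n) atTop atTop) {L : ℝ}
    (hL : Tendsto (fun n => P.real (Z 0 ⁻¹' A n) / s n) atTop (𝓝 L)) :
    Tendsto (fun k : ℕ × Ω => (∑ i ∈ Finset.range k.1,
      (A k.1).indicator (fun _ => (1 : ℝ)) (Z i k.2)) / (k.1 * s k.1)) (probFilter P) (𝓝 L) := by
  have hdev : Tendsto (fun k : ℕ × Ω => (∑ i ∈ Finset.range k.1,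
      (A k.1).indicator (fun _ => (1 : ℝ)) (Z i k.2)) / (k.1 * s k.1)
        - P.real (Z 0 ⁻¹' A k.1) / s k.1) (probFilter P) (𝓝 0) := by
    rw [Metric.tendsto_nhds]
    intro ε hε
    rw [eventually_probFilter_iff]
    have hb : Tendsto (fun n : ℕ => ENNReal.ofReal
        (P.real (Z 0 ⁻¹' A n) / s n * (n * s n)⁻¹ / ε ^ 2)) atTop (𝓝 0) := by
      have := (hL.mul hs.inv_tendsto_atTop).div_const (ε ^ 2)
      simpa using ENNReal.tendsto_ofReal this
    refine tendsto_of_tendsto_of_tendsto_of_le_of_le' tendsto_const_nhds hb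
      (Eventually.of_forall fun _ => zero_le) ?_
    filter_upwards [hs.eventually_gt_atTop 0] with n hn
    have hs0 : s n ≠ 0 := right_ne_zero_of_mul hn.ne'
    have hn0 : (n : ℝ) ≠ 0 := left_ne_zero_of_mul hn.ne'
    have h := measure_count_deviation_le hZ hind hid (hA n) n (mul_pos hε hn)
    refine (measure_mono ?_).trans (h.trans (le_of_eq ?_))
    · intro ω hω
      simp only [Set.mem_ofPred_eq, not_lt, dist_zero_right, Real.norm_eq_abs] at hω ⊢
      rw [← mul_div_mul_left _ (s n) hn0, ← sub_div, abs_div, abs_of_pos hn, le_div_iff₀ hn] at hω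
      exact hω
    · congr 1
      field_simp
  have := hdev.add (hL.comp tendsto_fst_probFilter)
  simpa using this

end Count

/-! ### Minimizers of the check objective -/

section CheckFun

lemma checkFun_of_nonneg {τ u : ℝ} (hu : 0 ≤ u) : checkFun τ u = τ * u := by
  rcases hu.eq_or_lt with rfl | hu
  · simp [checkFun]
  · simp [checkFun, hu.not_ge]

lemma checkFun_of_nonpos {τ u : ℝ} (hu : u ≤ 0) : checkFun τ u = (τ - 1) * u := by
  simp [checkFun, hu]

variable {ι : Type*} {s : Finset ι} {y c : ι → ℝ} {τ q : ℝ}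

/-- The weighted mass strictly above a weighted sample quantile is at most `1 - τ`: otherwise a
small step to the right would decrease the objective. -/
lemma sum_gt_le_of_isMinOn
    (h : IsMinOn (fun q => ∑ i ∈ s, checkFun τ (y i - q) * c i) Set.univ q) :
    ∑ i ∈ s, (if q < y i then c i else 0) ≤ (1 - τ) * ∑ i ∈ s, c i := by
  -- a step so short that it passes no observation
  obtain ⟨d, hd, hd0⟩ : ∃ d : ℝ, (∀ i ∈ s, q < y i → q + d ≤ y i) ∧ 0 < d := by
    have h1 : ∀ᶠ d in 𝓝[>] (0 : ℝ), ∀ i ∈ s, q < y i → q + d ≤ y i := by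
      rw [Filter.eventually_all_finset]
      intro i _
      by_cases hi : q < y i
      · filter_upwards [Ioo_mem_nhdsGT (sub_pos.2 hi)] with d hd _
        linarith [hd.2]
      · simp [hi]
    exact (h1.and self_mem_nhdsWithin).exists
  have hmin := isMinOn_iff.1 h (q + d) (Set.mem_univ _)
  have hstep : ∀ i ∈ s, checkFun τ (y i - (q + d)) * c i
      = checkFun τ (y i - q) * c i + d * ((1 - τ) * c i - if q < y i then c i else 0) := by
    intro i hi
    by_cases hq : q < y i
    · rw [checkFun_of_nonneg (by linarith [hd i hi hq]), checkFun_of_nonneg (by linarith),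
        if_pos hq]
      ring
    · rw [checkFun_of_nonpos (by linarith [not_lt.1 hq]),
        checkFun_of_nonpos (by linarith [not_lt.1 hq]), if_neg hq]
      ring
  rw [Finset.sum_congr rfl hstep, Finset.sum_add_distrib, ← Finset.mul_sum,
    Finset.sum_sub_distrib, ← Finset.mul_sum] at hmin
  have := (mul_nonneg_iff_of_pos_left hd0).1 (le_add_iff_nonneg_right _ |>.1 hmin)
  linarith

/-- The weighted mass at or above a weighted sample quantile is at least `1 - τ`. -/
lemma le_sum_ge_of_isMinOn
    (h : IsMinOn (fun q => ∑ i ∈ s, checkFun τ (y i - q) * c i) Set.univ q) :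
    (1 - τ) * ∑ i ∈ s, c i ≤ ∑ i ∈ s, (if q ≤ y i then c i else 0) := by
  obtain ⟨d, hd, hd0⟩ : ∃ d : ℝ, (∀ i ∈ s, y i < q → y i ≤ q - d) ∧ 0 < d := by
    have h1 : ∀ᶠ d in 𝓝[>] (0 : ℝ), ∀ i ∈ s, y i < q → y i ≤ q - d := by
      rw [Filter.eventually_all_finset]
      intro i _
      by_cases hi : y i < q
      · filter_upwards [Ioo_mem_nhdsGT (sub_pos.2 hi)] with d hd _
        linarith [hd.2]
      · simp [hi]
    exact (h1.and self_mem_nhdsWithin).exists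
  have hmin := isMinOn_iff.1 h (q - d) (Set.mem_univ _)
  have hstep : ∀ i ∈ s, checkFun τ (y i - (q - d)) * c i
      = checkFun τ (y i - q) * c i + d * ((if q ≤ y i then c i else 0) - (1 - τ) * c i) := by
    intro i hi
    by_cases hq : q ≤ y i
    · rw [checkFun_of_nonneg (by linarith), checkFun_of_nonneg (by linarith), if_pos hq]
      ring
    · rw [checkFun_of_nonpos (by linarith [hd i hi (not_le.1 hq)]),
        checkFun_of_nonpos (by linarith [not_le.1 hq]), if_neg hq]
      ring
  rw [Finset.sum_congr rfl hstep, Finset.sum_add_distrib, ← Finset.mul_sum,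
    Finset.sum_sub_distrib, ← Finset.mul_sum] at hmin
  have := (mul_nonneg_iff_of_pos_left hd0).1 (le_add_iff_nonneg_right _ |>.1 hmin)
  linarith

end CheckFun

/-! ### Distribution functions near their right endpoint -/

section Endpoint

variable {ν : Measure ℝ}

lemma cdf_lt_one_of_lt_rightEndpoint {y : ℝ} (hy : y < rightEndpoint (cdf ν)) :
    cdf ν y < 1 := by
  have hne : {z | cdf ν z < 1}.Nonempty :=
    ((tendsto_cdf_atBot ν).eventually_lt_const one_pos).exists
  obtain ⟨z, hz, hyz⟩ := exists_lt_of_lt_csSup hne hy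
  exact (monotone_cdf ν hyz.le).trans_lt hz

variable [IsProbabilityMeasure ν]

lemma continuous_cdf [NullSingletonClass ν] : Continuous (cdf ν) := by
  rw [continuous_iff_continuousAt]
  intro a
  have h : (cdf ν).measure {a} = 0 := by rw [measure_cdf]; exact measure_singleton a
  rw [StieltjesFunction.measure_singleton, ENNReal.ofReal_eq_zero] at h
  rw [(monotone_cdf ν).continuousAt_iff_leftLim_eq_rightLim, (cdf ν).rightLim_eq]
  exact le_antisymm ((monotone_cdf ν).leftLim_le le_rfl) (by linarith)

lemma cdf_rightEndpoint_eq_one [NullSingletonClass ν] (hb : BddAbove {z | cdf ν z < 1}) :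
    cdf ν (rightEndpoint (cdf ν)) = 1 := by
  refine le_antisymm (cdf_le_one ν _) ?_
  have hlim : Tendsto (cdf ν) (𝓝[>] rightEndpoint (cdf ν)) (𝓝 (cdf ν (rightEndpoint (cdf ν)))) :=
    (continuous_cdf.tendsto _).mono_left nhdsWithin_le_nhds
  refine ge_of_tendsto hlim ?_
  filter_upwards [self_mem_nhdsWithin] with y hy
  by_contra! h
  exact (not_le.2 hy) (le_csSup hb h)

/-- A continuous distribution function with finite right endpoint attains every tail probability
below that endpoint. -/
lemma exists_tail_eq [NullSingletonClass ν] (hb : BddAbove {z | cdf ν z < 1}) {t : ℝ}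
    (ht : t ∈ Set.Ioo (0 : ℝ) 1) :
    ∃ z, 0 < z ∧ 1 - cdf ν (rightEndpoint (cdf ν) - z) = t := by
  set e := rightEndpoint (cdf ν)
  have he : cdf ν e = 1 := cdf_rightEndpoint_eq_one hb
  obtain ⟨a, ha, hae⟩ := (((tendsto_cdf_atBot ν).eventually_lt_const
    (sub_pos.2 ht.2)).and (eventually_le_atBot e)).exists
  obtain ⟨y, hy, hyt⟩ := intermediate_value_Icc hae continuous_cdf.continuousOn
    (show 1 - t ∈ Set.Icc (cdf ν a) (cdf ν e) from ⟨ha.le, by linarith [ht.1]⟩)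
  have hye : y ≠ e := by
    rintro rfl
    linarith [ht.1]
  exact ⟨e - y, sub_pos.2 (lt_of_le_of_ne hy.2 hye), by rw [sub_sub_cancel, hyt]; ring⟩

/-- Tail quantiles: for tail probabilities `t n > 0` tending to zero, the distances `z n` from the
right endpoint at which they are attained tend to zero, and the tail at `v * z n` is `v ^ (-1 / ξ)`
times as large in the limit. -/
lemma exists_tail_scale [NullSingletonClass ν] {ξ : ℝ} (hF : InTypeThreeDomain (cdf ν) ξ) {t : ℕ → ℝ}
    (ht0 : ∀ᶠ n in atTop, 0 < t n) (ht : Tendsto t atTop (𝓝 0)) :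
    ∃ z : ℕ → ℝ, (∀ n, 0 < z n) ∧ ∀ v, 0 < v →
      Tendsto (fun n => ν.real (Set.Ioi (rightEndpoint (cdf ν) - v * z n)) / t n) atTop
        (𝓝 (v ^ (-1 / ξ))) := by
  obtain ⟨-, hb, hrv⟩ := hF
  set e := rightEndpoint (cdf ν) with he
  have hex : ∀ n, ∃ z, 0 < z ∧ (t n ∈ Set.Ioo (0 : ℝ) 1 → 1 - cdf ν (e - z) = t n) := fun n => by
    by_cases h : t n ∈ Set.Ioo (0 : ℝ) 1
    · obtain ⟨z, hz, hzt⟩ := exists_tail_eq hb h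
      exact ⟨z, hz, fun _ => hzt⟩
    · exact ⟨1, one_pos, fun h' => absurd h' h⟩
  choose z hz0 hz using hex
  have hzt : ∀ᶠ n in atTop, 1 - cdf ν (e - z n) = t n := by
    filter_upwards [ht0, ht.eventually_lt_const one_pos] with n h1 h2 using hz n ⟨h1, h2⟩
  have hzlim : Tendsto z atTop (𝓝[>] 0) := by
    rw [tendsto_nhdsWithin_iff]
    refine ⟨?_, Eventually.of_forall hz0⟩
    refine tendsto_order.2 ⟨fun a ha => Eventually.of_forall fun n => ha.trans (hz0 n),
      fun a ha => ?_⟩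
    have hpos : 0 < 1 - cdf ν (e - a) :=
      sub_pos.2 (cdf_lt_one_of_lt_rightEndpoint (by linarith))
    filter_upwards [hzt, ht.eventually_lt_const hpos] with n h1 h2
    by_contra! h
    have := monotone_cdf ν (show e - z n ≤ e - a by linarith)
    linarith
  refine ⟨z, hz0, fun v hv => ((hrv v hv).comp hzlim).congr' ?_⟩
  filter_upwards [hzt] with n hn
  simp only [Function.comp_apply]
  rw [hn, cdf_eq_real, ← probReal_compl_eq_one_sub measurableSet_Iic, Set.compl_Iic]

end Endpoint

/-! ### Consistency of intermediate quantiles -/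

section Quantile

variable {Ω : Type*} [MeasurableSpace Ω] {P : Measure Ω} [IsProbabilityMeasure P] {p : ℕ}
  {X : ℕ → Ω → Fin p → ℝ} {Y : ℕ → Ω → ℝ} {x : Fin p → ℝ}

/-- The probability that `X ≤ x` and `Y` lies in `B`, in terms of the conditional law. -/
lemma measureReal_le_inter_eq {U : Ω → Fin p → ℝ} {V : Ω → ℝ} (hU : Measurable U)
    (hV : Measurable V) {B : Set ℝ} (hB : MeasurableSet B) (x : Fin p → ℝ) :
    P.real {ω | U ω ≤ x ∧ V ω ∈ B} = P.real {ω | U ω ≤ x} * (condLaw P U V x).real B := by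
  have hm : MeasurableSet {ω | U ω ≤ x} := hU measurableSet_Iic
  rw [condLaw, map_measureReal_apply hV hB, mul_comm, Measure.real, Measure.real, Measure.real,
    ← ENNReal.toReal_mul, cond_mul_eq_inter hm]
  rfl

/-- Intermediate sample quantiles: if the tail of the conditional law at `e - v * z n` is about
`v ^ α * t n` for every `v > 0`, and `n * t n → ∞`, then the estimated quantile at `1 - c * t n` is
`e - c ^ (1 / α) * z n` up to an error that is negligible against `z n`. -/
lemma tendsto_endpoint_sub_quantile_div (hX : ∀ i, Measurable (X i)) (hY : ∀ i, Measurable (Y i))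
    (hindep : iIndepFun (fun i ω => (X i ω, Y i ω)) P)
    (hident : ∀ i, IdentDistrib (fun ω => (X i ω, Y i ω)) (fun ω => (X 0 ω, Y 0 ω)) P P)
    (hp₀ : 0 < P.real {ω | X 0 ω ≤ x}) [NullSingletonClass (condLaw P (X 0) (Y 0) x)]
    {qhat : ℕ → ℝ → Ω → ℝ} (hqhat : IsQuantileEstimator X Y x qhat)
    {t z : ℕ → ℝ} (ht0 : ∀ᶠ n in atTop, 0 < t n) (ht : Tendsto t atTop (𝓝 0))
    (hnt : Tendsto (fun n : ℕ => n * t n) atTop atTop) (hz : ∀ n, 0 < z n) {e α : ℝ} (hα : 0 < α)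
    (htail : ∀ v, 0 < v → Tendsto
      (fun n => (condLaw P (X 0) (Y 0) x).real (Set.Ioi (e - v * z n)) / t n) atTop (𝓝 (v ^ α)))
    {c : ℝ} (hc : 0 < c) :
    Tendsto (fun k : ℕ × Ω => (e - qhat k.1 (1 - c * t k.1) k.2) / z k.1) (probFilter P)
      (𝓝 (c ^ (1 / α))) := by
  classical
  set p₀ := P.real {ω | X 0 ω ≤ x} with hp
  set Z : ℕ → Ω → (Fin p → ℝ) × ℝ := fun i ω => (X i ω, Y i ω) with hZdef
  have hZ : ∀ i, Measurable (Z i) := fun i => (hX i).prodMk (hY i)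
  set wt : ℕ → Ω → ℝ := fun i ω => if X i ω ≤ x then 1 else 0 with hwt
  have hwt0 : ∀ i ω, 0 ≤ wt i ω := fun i ω => by simp only [hwt]; split_ifs <;> norm_num
  have hIic : MeasurableSet {u : Fin p → ℝ | u ≤ x} := measurableSet_Iic
  have hN : Tendsto (fun k : ℕ × Ω => c * ((∑ i ∈ Finset.range k.1, wt i k.2) / k.1))
      (probFilter P) (𝓝 (p₀ * c)) := by
    have h := tendsto_count_div hZ hindep hident (A := fun _ => {u | u.1 ≤ x}) (s := fun _ => 1)
      (fun _ => measurable_fst hIic) (L := p₀) (by simpa using tendsto_natCast_atTop_atTop)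
      (by simp only [div_one]; exact tendsto_const_nhds)
    rw [mul_comm p₀]
    refine (h.const_mul c).congr fun k => ?_
    simp [hwt, hZdef, Set.indicator_apply]
  have hcount : ∀ B : ℕ → Set ℝ, (∀ n, MeasurableSet (B n)) → ∀ L : ℝ,
      Tendsto (fun n => (condLaw P (X 0) (Y 0) x).real (B n) / t n) atTop (𝓝 L) →
      Tendsto (fun k : ℕ × Ω => (∑ i ∈ Finset.range k.1, (B k.1).indicator (fun _ => wt i k.2) (Y i k.2))
        / (k.1 * t k.1)) (probFilter P) (𝓝 (p₀ * L)) := by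
    intro B hB L hL
    have h := tendsto_count_div hZ hindep hident (A := fun n => {u | u.1 ≤ x ∧ u.2 ∈ B n})
      (fun n => (measurable_fst hIic).inter (measurable_snd (hB n))) hnt (L := p₀ * L) (by
        refine (hL.const_mul p₀).congr fun n => ?_
        rw [← mul_div_assoc, hp, ← measureReal_le_inter_eq (hX 0) (hY 0) (hB n)]
        rfl)
    refine h.congr fun k => ?_
    congr 1
    refine Finset.sum_congr rfl fun i _ => ?_
    by_cases h1 : X i k.2 ≤ x <;> by_cases h2 : Y i k.2 ∈ B k.1 <;> simp [hwt, hZdef, h1, h2]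
  have hvalid : ∀ᶠ k in probFilter P, 0 < t k.1 ∧ c * t k.1 < 1 ∧ 0 < (k.1 : ℝ) := by
    refine tendsto_fst_probFilter.eventually (p := fun n : ℕ => 0 < t n ∧ c * t n < 1 ∧ 0 < (n : ℝ))
      ?_
    have h1 : Tendsto (fun n => c * t n) atTop (𝓝 0) := by simpa using ht.const_mul c
    filter_upwards [ht0, h1.eventually_lt_const one_pos, eventually_gt_atTop 0] with n a b d
    exact ⟨a, b, by exact_mod_cast d⟩
  have hmin : ∀ k : ℕ × Ω, 0 < t k.1 → c * t k.1 < 1 →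
      IsMinOn (fun q => ∑ i ∈ Finset.range k.1, checkFun (1 - c * t k.1) (Y i k.2 - q) * wt i k.2)
        Set.univ (qhat k.1 (1 - c * t k.1) k.2) := by
    intro k h1 h2
    have h := hqhat k.1 (1 - c * t k.1) ⟨by linarith, by linarith [mul_pos hc h1]⟩ k.2
    unfold quantileObjective at h
    convert h
  have hlt : ∀ v, 0 < v → (v < c ^ (1 / α) ↔ v ^ α < c) := fun v hv => by
    rw [one_div, Real.lt_rpow_inv_iff_of_pos hv.le hc.le hα]
  have hgt : ∀ v, 0 < v → (c ^ (1 / α) < v ↔ c < v ^ α) := fun v hv => by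
    rw [one_div, Real.rpow_inv_lt_iff_of_pos hc.le hv.le hα]
  refine tendsto_order.2 ⟨fun a ha => ?_, fun a ha => ?_⟩
  -- `a` may be negative, so the threshold is taken at a positive `v` above it
  · obtain ⟨v, hv, hvc⟩ := exists_between (max_lt ha (Real.rpow_pos_of_pos hc (1 / α)))
    obtain ⟨hav, hv0⟩ := max_lt_iff.1 hv
    have hcmp := (hcount (fun n => Set.Ici (e - v * z n)) (fun _ => measurableSet_Ici) _
      (by simpa only [measureReal_congr (Ioi_ae_eq_Ici (μ := condLaw P (X 0) (Y 0) x))]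
        using htail v hv0)).eventually_lt hN
      (mul_lt_mul_of_pos_left ((hlt v hv0).1 hvc) hp₀)
    filter_upwards [hcmp, hvalid] with k hk hval
    obtain ⟨h1, h2, h3⟩ := hval
    by_contra! hle
    rw [div_le_iff₀ (hz k.1)] at hle
    have hq : e - v * z k.1 ≤ qhat k.1 (1 - c * t k.1) k.2 := by
      nlinarith [mul_lt_mul_of_pos_right hav (hz k.1)]
    have hge := le_sum_ge_of_isMinOn (hmin k h1 h2)
    have hmono : ∑ i ∈ Finset.range k.1,
        (if qhat k.1 (1 - c * t k.1) k.2 ≤ Y i k.2 then wt i k.2 else 0) ≤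
        ∑ i ∈ Finset.range k.1, (Set.Ici (e - v * z k.1)).indicator (fun _ => wt i k.2) (Y i k.2) := by
      refine Finset.sum_le_sum fun i _ => ?_
      by_cases hi : qhat k.1 (1 - c * t k.1) k.2 ≤ Y i k.2
      · rw [if_pos hi, Set.indicator_of_mem (Set.mem_Ici.2 (hq.trans hi))]
      · rw [if_neg hi]
        exact Set.indicator_nonneg (fun _ _ => hwt0 _ _) _
    rw [div_lt_iff₀ (mul_pos h3 h1)] at hk
    have : c * ((∑ i ∈ Finset.range k.1, wt i k.2) / k.1) * (k.1 * t k.1)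
        = (1 - (1 - c * t k.1)) * ∑ i ∈ Finset.range k.1, wt i k.2 := by
      field_simp
      ring
    linarith
  · have ha0 : 0 < a := (Real.rpow_pos_of_pos hc _).trans ha
    have hcmp := hN.eventually_lt (hcount (fun n => Set.Ioi (e - a * z n))
      (fun _ => measurableSet_Ioi) _ (htail a ha0))
      (mul_lt_mul_of_pos_left ((hgt a ha0).1 ha) hp₀)
    filter_upwards [hcmp, hvalid] with k hk hval
    obtain ⟨h1, h2, h3⟩ := hval
    by_contra! hle
    rw [le_div_iff₀ (hz k.1)] at hle
    have hq : qhat k.1 (1 - c * t k.1) k.2 ≤ e - a * z k.1 := by linarith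
    have hge := sum_gt_le_of_isMinOn (hmin k h1 h2)
    have hmono : ∑ i ∈ Finset.range k.1,
        (Set.Ioi (e - a * z k.1)).indicator (fun _ => wt i k.2) (Y i k.2) ≤
        ∑ i ∈ Finset.range k.1,
          if qhat k.1 (1 - c * t k.1) k.2 < Y i k.2 then wt i k.2 else 0 := by
      refine Finset.sum_le_sum fun i _ => ?_
      by_cases hi : Y i k.2 ∈ Set.Ioi (e - a * z k.1)
      · rw [Set.indicator_of_mem hi, if_pos (hq.trans_lt hi)]
      · rw [Set.indicator_of_notMem hi]
        split_ifs
        exacts [hwt0 _ _, le_rfl]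
    rw [lt_div_iff₀ (mul_pos h3 h1)] at hk
    have : c * ((∑ i ∈ Finset.range k.1, wt i k.2) / k.1) * (k.1 * t k.1)
        = (1 - (1 - c * t k.1)) * ∑ i ∈ Finset.range k.1, wt i k.2 := by
      field_simp
      ring
    linarith

end Quantile

/-! ### The Pickands-type estimator -/

lemma IsIntermediate.eventually_pos {τ : ℕ → ℝ} (h : IsIntermediate τ) :
    ∀ᶠ n in atTop, 0 < 1 - τ n := by
  obtain ⟨-, C, hC, δ, -, hb⟩ := h
  filter_upwards [hb, eventually_gt_atTop 0] with n hn hn0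
  have hn' : (0 : ℝ) < n := by exact_mod_cast hn0
  exact (pos_iff_pos_of_mul_pos ((mul_pos hC (Real.rpow_pos_of_pos hn' δ)).trans_le hn)).1 hn'

lemma IsIntermediate.tendsto_mul_atTop {τ : ℕ → ℝ} (h : IsIntermediate τ) :
    Tendsto (fun n : ℕ => n * (1 - τ n)) atTop atTop := by
  obtain ⟨-, C, hC, δ, hδ, hb⟩ := h
  exact tendsto_atTop_mono' _ hb
    (((tendsto_rpow_atTop hδ).comp tendsto_natCast_atTop_atTop).const_mul_atTop hC)

theorem mainTheorem9 {Ω : Type*} [MeasurableSpace Ω] (P : Measure Ω) [IsProbabilityMeasure P]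
    {p : ℕ} (X : ℕ → Ω → Fin p → ℝ) (Y : ℕ → Ω → ℝ) (x : Fin p → ℝ)
    (hX : ∀ i, Measurable (X i)) (hY : ∀ i, Measurable (Y i))
    (hindep : iIndepFun (fun i ω => (X i ω, Y i ω)) P)
    (hident : ∀ i, IdentDistrib (fun ω => (X i ω, Y i ω)) (fun ω => (X 0 ω, Y 0 ω)) P P)
    (hp₀ : 0 < P {ω | X 0 ω ≤ x})
    (ξ₀ : ℝ) (hev : InTypeThreeDomain (condDF P (X 0) (Y 0) x) ξ₀)
    (hdens : HasTailMonotoneDensity (condLaw P (X 0) (Y 0) x)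
      (rightEndpoint (condDF P (X 0) (Y 0) x)))
    (τ : ℕ → ℝ) (hτ : IsIntermediate τ)
    (qhat : ℕ → ℝ → Ω → ℝ) (hqhat : IsQuantileEstimator X Y x qhat)
    (R : ℕ) (hR : 0 < R) (w : ℕ → ℝ) (hw : ∑ r ∈ Finset.Icc 1 R, w r = 1)
    (l m : ℝ) (hl : 0 < l) (hl1 : l ≠ 1) (hm : 0 < m) (hm1 : m ≠ 1) :
    Tendsto (fun n => P {ω | ¬ PickandsDefined qhat τ R l m n ω}) atTop (𝓝 0) ∧
      TendstoInMeasure P (fun n ω => pickandsEstimator qhat τ R w l m n ω) atTop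
        (fun _ => ξ₀) := by
  have hcond : IsProbabilityMeasure (ProbabilityTheory.cond P {ω | X 0 ω ≤ x}) :=
    cond_isProbabilityMeasure hp₀.ne'
  have hν : IsProbabilityMeasure (condLaw P (X 0) (Y 0) x) :=
    Measure.isProbabilityMeasure_map (hY 0).aemeasurable
  have hatoms : NullSingletonClass (condLaw P (X 0) (Y 0) x) := by
    obtain ⟨f, -, -, hf, -⟩ := hdens
    rw [hf]
    infer_instance
  have hF : condDF P (X 0) (Y 0) x = cdf (condLaw P (X 0) (Y 0) x) :=
    funext fun y => (cdf_eq_real _ y).symm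
  rw [hF] at hev
  have hξ : ξ₀ < 0 := hev.1
  have hα : 0 < -1 / ξ₀ := div_pos_of_neg_of_neg (by norm_num) hξ
  have hinv : 1 / (-1 / ξ₀) = -ξ₀ := by field_simp
  have ht0 := hτ.eventually_pos
  have ht : Tendsto (fun n => 1 - τ n) atTop (𝓝 0) := by simpa using hτ.1.const_sub 1
  obtain ⟨z, hz, htail⟩ := exists_tail_scale hev ht0 ht
  have hq := fun c hc => tendsto_endpoint_sub_quantile_div (c := c) hX hY hindep hident
    (ENNReal.toReal_pos hp₀.ne' (measure_ne_top _ _)) hqhat ht0 ht hτ.tendsto_mul_atTop hz hα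
    htail hc
  rw [hinv] at hq
  have hm' : 1 - m ^ (-ξ₀) ≠ 0 := by
    intro h
    refine hm1 ((Real.rpow_left_inj hm.le zero_le_one (neg_ne_zero.2 hξ.ne)).1 ?_)
    rw [Real.one_rpow]
    linarith
  have hspacing : ∀ r : ℕ, Tendsto
      (fun k : ℕ × Ω => tailSpacing qhat m (l ^ r * (1 - τ k.1)) k.1 k.2 / z k.1) (probFilter P)
      (𝓝 ((l ^ r) ^ (-ξ₀) * (1 - m ^ (-ξ₀)))) := by
    intro r
    have hc : 0 < l ^ r := pow_pos hl r
    have h := (hq _ hc).sub (hq _ (mul_pos hm hc))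
    rw [Real.mul_rpow hm.le hc.le] at h
    convert h using 2 with k
    · rw [tailSpacing, ← mul_assoc]
      ring
    · ring
  have hratio : ∀ r ∈ Finset.Icc 1 R, Tendsto
      (fun k : ℕ × Ω => tailSpacing qhat m (l ^ r * (1 - τ k.1)) k.1 k.2 /
        tailSpacing qhat m (l ^ (r - 1) * (1 - τ k.1)) k.1 k.2) (probFilter P)
      (𝓝 (l ^ (-ξ₀))) := by
    intro r hr
    have hpow : 0 < (l ^ (r - 1)) ^ (-ξ₀) := Real.rpow_pos_of_pos (pow_pos hl _) _
    have h := (hspacing r).div (hspacing (r - 1)) (mul_ne_zero hpow.ne' hm')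
    have hlr : l ^ r = l * l ^ (r - 1) := by
      rw [← pow_succ', Nat.sub_add_cancel (Finset.mem_Icc.1 hr).1]
    rw [mul_div_mul_right _ _ hm', hlr, Real.mul_rpow hl.le (pow_pos hl _).le,
      mul_div_cancel_right₀ _ hpow.ne'] at h
    refine h.congr fun k => ?_
    rw [Pi.div_apply, div_div_div_cancel_right₀ (hz k.1).ne', hlr]
  have hlpos : 0 < l ^ (-ξ₀) := Real.rpow_pos_of_pos hl _
  refine ⟨?_, tendstoInMeasure_of_tendsto_probFilter ?_⟩
  · refine (eventually_probFilter_iff (P := P)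
      (Q := fun k => PickandsDefined qhat τ R l m k.1 k.2)).1 ?_
    exact (Filter.eventually_all_finset _).2 fun r hr => (hratio r hr).eventually_const_lt hlpos
  · have hlog : Real.log l ≠ 0 := Real.log_ne_zero_of_pos_of_ne_one hl hl1
    have h := tendsto_finsetSum (Finset.Icc 1 R) fun r hr =>
      ((hratio r hr).log hlpos.ne').const_mul (-w r / Real.log l)
    have hsum : ∑ r ∈ Finset.Icc 1 R, -w r / Real.log l * Real.log (l ^ (-ξ₀)) = ξ₀ := by
      rw [← Finset.sum_mul, ← Finset.sum_div, Finset.sum_neg_distrib, hw, Real.log_rpow hl]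
      field_simp
    rw [hsum] at h
    exact h
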